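/- Let $n\ge 1$, let $\tilde A\subset\mathbb{C}^n$ be an irreducible complex algebraic curve, and let $a$ be a singular point of $\tilde A$ (a point near which $\tilde A$ is not a complex submanifold). Suppose that $\varphi$ is a Puiseux parametrization of $\tilde A$ at $a$ with exponent $k\ge 1$. This means that $\varphi$ is a holomorphic map on the unit disc $D(0,1)\subset\mathbb{C}$ with $\varphi(0)=a$, that $\varphi$ maps $D(0,1)$ bijectively onto $\tilde A\cap U$ for some open neighbourhood $U$ of $a$ in $\mathbb{C}^n$, and that in suitable unitary coordinates of $\mathbb{C}^n$ centred at $a$ $$\varphi(\xi)=(c\,\xi^k,\psi_2(\xi),\dots,\psi_n(\xi)),\qquad \xi\in D(0,1),$$ with a constant $c\neq 0$ and holomorphic functions $\psi_j$ such that $\operatorname{ord}_0\psi_j>k$ for $j=2,\dots,n$. Then $k$ is the multiplicity of $\tilde A$ at $a$: $$k=\mu_a(\tilde A):=\min\{\mu_a(\pi_L|_{\tilde A}) : L\subset\mathbb{C}^n \text{ a complex subspace of dimension } n-1\}.$$ Here $\pi_L:\mathbb{C}^n=L\oplus L^\perp\to L^\perp$ is the orthogonal projection. The minimum is taken over those $L$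 for which $a$ is an isolated point of $\tilde A\cap(a+L)$, and $\mu_a(\pi_L|_{\tilde A})$ is then the number of sheets of the ramified covering $\tilde A\cap U'\to V'$ that $\pi_L$ induces between suitable small neighbourhoods of $a$ in $\tilde A$ and of $\pi_L(a)$ in $L^\perp$, with $a$ the only point of $\tilde A\cap U'$ over $\pi_L(a)$. -/

import Mathlib

open Set Topology

/-- Hermitian space `ℂⁿ`. -/
abbrev CSpace (n : ℕ) : Type := EuclideanSpace ℂ (Fin n)

/-- The ideal `I(A)` of all polynomials in `ℂ[x₁, …, xₙ]` vanishing on `A ⊆ ℂⁿ`. -/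
noncomputable def idealOf {n : ℕ} (A : Set (CSpace n)) : Ideal (MvPolynomial (Fin n) ℂ) :=
  MvPolynomial.vanishingIdeal ℂ {x : Fin n → ℂ | WithLp.toLp 2 x ∈ A}

/-- `A ⊆ ℂⁿ` is algebraic if it is the common zero locus of the ideal `I(A)`. -/
def IsAlgebraicSet {n : ℕ} (A : Set (CSpace n)) : Prop :=
  {z : CSpace n | ∀ p ∈ idealOf A, MvPolynomial.eval (fun i => z i) p = 0} = A

/-- An irreducible algebraic set: non-empty, and not the union of two proper algebraic subsets. -/
def IsIrreducibleAlgebraicSet {n : ℕ} (A : Set (CSpace n)) : Prop :=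
  IsAlgebraicSet A ∧ A.Nonempty ∧
    ∀ B C : Set (CSpace n), IsAlgebraicSet B → IsAlgebraicSet C → A = B ∪ C → A = B ∨ A = C

/-- An irreducible algebraic curve in `ℂⁿ`: an irreducible algebraic set of dimension one (the
dimension is the Krull dimension of the coordinate ring `ℂ[x₁, …, xₙ] / I(A)`). -/
def IsIrreducibleAlgebraicCurve {n : ℕ} (A : Set (CSpace n)) : Prop :=
  IsIrreducibleAlgebraicSet A ∧ ringKrullDim (MvPolynomial (Fin n) ℂ ⧸ idealOf A) = 1

/-- `a` is a regular point of `A`: near `a` the set `A` is a complex submanifold of `ℂⁿ`, that is,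
the zero set of a holomorphic map whose differential at `a` is surjective. -/
def IsRegularPoint {n : ℕ} (A : Set (CSpace n)) (a : CSpace n) : Prop :=
  a ∈ A ∧ ∃ (m : ℕ) (U : Set (CSpace n)) (f : CSpace n → CSpace m),
    IsOpen U ∧ a ∈ U ∧ DifferentiableOn ℂ f U ∧ Function.Surjective (fderiv ℂ f a) ∧
      A ∩ U = {z ∈ U | f z = 0}

/-- `a` is a singular point of `A`: a point of `A` that is not regular. -/
def IsSingularPoint {n : ℕ} (A : Set (CSpace n)) (a : CSpace n) : Prop :=
  a ∈ A ∧ ¬ IsRegularPoint A a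

/-- `φ` is a Puiseux parametrization with exponent `k` of `A` at `a`: a holomorphic map on the
unit disc with `φ(0) = a` that maps the disc bijectively onto `A ∩ U`, with `U` an open
neighbourhood of `a`, and that has, in suitable unitary coordinates `l` centred at `a`, the form
`ξ ↦ (c ξᵏ, ψ₂(ξ), …, ψₙ(ξ))` with `c ≠ 0`, `k ≥ 1` and `ord₀ ψⱼ > k` for all `j`. -/
def IsPuiseuxParametrization {n : ℕ} [NeZero n] (A : Set (CSpace n)) (a : CSpace n)
    (φ : ℂ → CSpace n) (k : ℕ) : Prop :=
  1 ≤ k ∧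
  DifferentiableOn ℂ φ (Metric.ball 0 1) ∧
  φ 0 = a ∧
  (∃ U : Set (CSpace n), IsOpen U ∧ a ∈ U ∧ BijOn φ (Metric.ball 0 1) (A ∩ U)) ∧
  ∃ (l : CSpace n ≃ₗᵢ[ℂ] CSpace n) (c : ℂ), c ≠ 0 ∧
    (∀ ξ ∈ Metric.ball (0 : ℂ) 1, l (φ ξ - a) 0 = c * ξ ^ k) ∧
    ∀ j : Fin n, j ≠ 0 → (k : ℕ∞) < analyticOrderAt (fun ξ => l (φ ξ - a) j) 0

/-- The orthogonal projection `π_L : ℂⁿ = L ⊕ L^⊥ → L^⊥`. -/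
noncomputable def projAlong {n : ℕ} (L : Submodule ℂ (CSpace n)) : CSpace n →L[ℂ] Lᗮ :=
  Lᗮ.orthogonalProjectionOnto

/-- `μ_a(π_L|_A) = m`: near `a`, where `a` is isolated in its fibre of `π_L|_A`, the projection
`π_L` restricts to a ramified covering with `m` sheets. That is, there are open neighbourhoods
`U` of `a` and `V` of `π_L(a)` such that `π_L` restricts to a proper map `A ∩ U → V` with fibre
`{a}` over `π_L(a)`, and, off a nowhere dense set `σ` of critical values, every fibre over a point
of `V` has exactly `m` points. If `a` is not isolated in its fibre, no `m` qualifies. -/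
def IsProjectionMultiplicity {n : ℕ} (A : Set (CSpace n)) (a : CSpace n)
    (L : Submodule ℂ (CSpace n)) (m : ℕ) : Prop :=
  ∃ (U : Set (CSpace n)) (V : Set Lᗮ),
    IsOpen U ∧ IsOpen V ∧ a ∈ U ∧
    MapsTo (projAlong L) (A ∩ U) V ∧
    (∀ K : Set Lᗮ, K ⊆ V → IsCompact K → IsCompact (A ∩ U ∩ projAlong L ⁻¹' K)) ∧
    A ∩ U ∩ projAlong L ⁻¹' {projAlong L a} = {a} ∧
    ∃ σ : Set Lᗮ, IsNowhereDense σ ∧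
      ∀ w ∈ V \ σ, (A ∩ U ∩ projAlong L ⁻¹' {w}).encard = m

/-- The set of all values `μ_a(π_L|_A)`, where `L` runs through the Grassmannian of
`(n - p)`-dimensional complex subspaces of `ℂⁿ` (and `a` is isolated in its fibre). -/
def projectionMultiplicities {n : ℕ} (p : ℕ) (A : Set (CSpace n)) (a : CSpace n) : Set ℕ :=
  {m | ∃ L : Submodule ℂ (CSpace n),
    Module.finrank ℂ L + p = n ∧ IsProjectionMultiplicity A a L m}

/-- `μ_a(A) = m` for a set `A ⊆ ℂⁿ` of pure dimension `p`: `m` is the minimum of the multiplicities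
`μ_a(π_L|_A)`. -/
def IsMultiplicity {n : ℕ} (p : ℕ) (A : Set (CSpace n)) (a : CSpace n) (m : ℕ) : Prop :=
  IsLeast (projectionMultiplicities p A a) m

/-! After identifying `Lᗮ` with `ℂ`, the projection along a hyperplane `L` pulls back under `φ` to a
holomorphic function `f` on the disc with `f 0 = 0`. Since `φ` is injective, solutions of `f = w`
near `0` give distinct points of the fibre. Lower bound (`le_of_isProjectionMultiplicity`): all
coordinates of `φ - a` vanish to order at least `k`, hence so does `f`. Its order `q` is finite
because `a` is isolated in its fibre, and `f` takes small nonzero values at least `q ≥ k` times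
(`AnalyticAt.eventually_le_encard_fiber`). Attainment (`mem_projectionMultiplicities`): for `L`
orthogonal to the tangent line, `f` is `c ξ ^ k`, with exactly `k` roots over each nonzero value. -/

open Filter in
/-- The punctured neighbourhoods of a non-isolated point are not contained in a nowhere dense
set. -/
lemma IsNowhereDense.frequently_notMem {X : Type*} [TopologicalSpace X] [T1Space X] {s : Set X}
    (hs : IsNowhereDense s) (a : X) [NeBot (𝓝[≠] a)] : ∃ᶠ x in 𝓝[≠] a, x ∉ s := by
  intro h
  simp only [not_not] at h
  obtain ⟨O, hO, haO, hOs⟩ := mem_nhdsWithin.1 h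
  obtain ⟨x, hxO, hxa⟩ :=
    (inter_mem (mem_nhdsWithin_of_mem_nhds (hO.mem_nhds haO)) self_mem_nhdsWithin :
      O ∩ {a}ᶜ ∈ 𝓝[≠] a) |> Filter.nonempty_of_mem
  have : x ∈ interior (closure s) :=
    interior_maximal (hOs.trans subset_closure) (hO.inter isOpen_compl_singleton) ⟨hxO, hxa⟩
  rw [hs] at this
  exact this

/-! ### Orders and fibres of holomorphic functions of one variable -/

/-- A nonzero complex number has exactly `q` roots of order `q`. -/
lemma Complex.encard_setOf_pow_eq {q : ℕ} (hq : q ≠ 0) {w : ℂ} (hw : w ≠ 0) :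
    {t : ℂ | t ^ q = w}.encard = q := by
  have hζ := Complex.isPrimitiveRoot_exp q hq
  have hset : {t : ℂ | t ^ q = w} = (Polynomial.nthRootsFinset q w : Set ℂ) := by
    ext t
    simp [Polynomial.mem_nthRootsFinset (Nat.pos_of_ne_zero hq)]
  have hcard : (Polynomial.nthRootsFinset q w).card = q := by
    classical
    rw [Polynomial.nthRootsFinset_def, Multiset.toFinset_card_of_nodup (hζ.nthRoots_nodup hw),
      hζ.card_nthRoots, if_pos (IsAlgClosed.exists_pow_nat_eq w (Nat.pos_of_ne_zero hq))]
  rw [hset, Set.encard_coe_eq_coe_finsetCard, hcard]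

open Filter in
/-- An analytic function with a zero of finite order `q ≥ 1` at the origin is near the origin the
`q`-th power of a local coordinate. -/
lemma AnalyticAt.exists_eventually_eq_pow {f : ℂ → ℂ} (hf : AnalyticAt ℂ f 0) {q : ℕ} (hq : q ≠ 0)
    (hord : analyticOrderAt f 0 = q) :
    ∃ h : ℂ → ℂ, map h (𝓝 0) = 𝓝 0 ∧ ∀ᶠ z in 𝓝 0, f z = h z ^ q := by
  obtain ⟨g, hg, hg0, hfg⟩ := hf.analyticOrderAt_eq_natCast.1 hord
  obtain ⟨s, hs⟩ := IsAlgClosed.exists_pow_nat_eq (g 0) (Nat.pos_of_ne_zero hq)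
  have hs0 : s ≠ 0 := by
    rintro rfl
    exact hg0 (by rw [← hs, zero_pow hq])
  -- A holomorphic branch of the `q`-th root of `g`. Dividing by `g 0` keeps the argument of `log`
  -- near `1`, away from the cut.
  have hG : AnalyticAt ℂ (fun z => s * Complex.exp (Complex.log (g z / g 0) / q)) 0 := by
    have hslit : g 0 / g 0 ∈ Complex.slitPlane := by simp [hg0]
    exact analyticAt_const.mul (((hg.div_const).clog hslit).div_const).cexp
  have hG0 : s * Complex.exp (Complex.log (g 0 / g 0) / q) = s := by simp [hg0]
  refine ⟨fun z => z * (s * Complex.exp (Complex.log (g z / g 0) / q)), ?_, ?_⟩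
  · have hder : HasStrictDerivAt (fun z => z * (s * Complex.exp (Complex.log (g z / g 0) / q)))
        s 0 := by
      have h1 := (hasStrictDerivAt_id (0 : ℂ)).mul hG.hasStrictDerivAt
      simp only [hG0, id_eq, one_mul, zero_mul, add_zero] at h1
      exact h1
    simpa using hder.map_nhds_eq hs0
  · filter_upwards [hfg, hg.continuousAt.eventually_ne hg0] with z hz hgz
    have hq' : (q : ℂ) ≠ 0 := Nat.cast_ne_zero.2 hq
    rw [hz, mul_pow, mul_pow, hs, ← Complex.exp_nat_mul, mul_div_cancel₀ _ hq',
      Complex.exp_log (div_ne_zero hgz hg0), mul_div_cancel₀ _ hg0, sub_zero, smul_eq_mul]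

open Filter in
/-- Near a zero of finite order `q ≥ 1` an analytic function takes all small nonzero values at
least `q` times. -/
lemma AnalyticAt.eventually_le_encard_fiber {f : ℂ → ℂ} (hf : AnalyticAt ℂ f 0) {q : ℕ}
    (hq : q ≠ 0) (hord : analyticOrderAt f 0 = q) {N : Set ℂ} (hN : N ∈ 𝓝 0) :
    ∀ᶠ w in 𝓝[≠] (0 : ℂ), (q : ℕ∞) ≤ (N ∩ f ⁻¹' {w}).encard := by
  obtain ⟨h, hmap, hfh⟩ := hf.exists_eventually_eq_pow hq hord
  have himg : h '' (N ∩ {z | f z = h z ^ q}) ∈ 𝓝 (0 : ℂ) :=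
    hmap ▸ image_mem_map (inter_mem hN hfh)
  obtain ⟨ε, hε, hball⟩ := Metric.mem_nhds_iff.1 himg
  -- For `‖w‖ < ε ^ q` all `q` roots of `t ^ q = w` have norm below `ε`, so each is a value of `h`
  -- on `N`.
  have hsmall : ∀ᶠ w in 𝓝[≠] (0 : ℂ), w ∈ Metric.ball (0 : ℂ) (ε ^ q) :=
    mem_nhdsWithin_of_mem_nhds (Metric.ball_mem_nhds _ (by positivity))
  filter_upwards [hsmall, self_mem_nhdsWithin] with w hw hw0
  rw [← Complex.encard_setOf_pow_eq hq hw0]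
  refine le_trans (Set.encard_le_encard ?_) (Set.encard_image_le h _)
  intro t ht
  have htε : t ∈ Metric.ball (0 : ℂ) ε := by
    rw [mem_ball_zero_iff] at hw ⊢
    rw [← ht, norm_pow] at hw
    exact lt_of_pow_lt_pow_left₀ q hε.le hw
  obtain ⟨z, ⟨hzN, hz⟩, rfl⟩ := hball htε
  exact ⟨z, ⟨hzN, Eq.trans hz ht⟩, rfl⟩

/-- A linear functional of a curve all of whose coordinates vanish to order `k` vanishes to
order `k`. -/
lemma le_analyticOrderAt_linearMap_comp {n : ℕ} {ψ : ℂ → CSpace n} {k : ℕ}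
    (hψ : ∀ j, AnalyticAt ℂ (fun ξ => ψ ξ j) 0)
    (hk : ∀ j, (k : ℕ∞) ≤ analyticOrderAt (fun ξ => ψ ξ j) 0) (T : CSpace n →ₗ[ℂ] ℂ) :
    (k : ℕ∞) ≤ analyticOrderAt (fun ξ => T (ψ ξ)) 0 := by
  have hT : (fun ξ => T (ψ ξ)) = fun ξ => ∑ j, ψ ξ j * T (EuclideanSpace.single j 1) := by
    funext ξ
    conv_lhs => rw [← (EuclideanSpace.basisFun (Fin n) ℂ).sum_repr (ψ ξ)]
    simp
  choose g hg hgψ using fun j => (natCast_le_analyticOrderAt (hψ j)).1 (hk j)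
  have hsum : AnalyticAt ℂ (fun ξ => ∑ j, ψ ξ j * T (EuclideanSpace.single j 1)) 0 :=
    Finset.analyticAt_fun_sum _ fun j _ => (hψ j).mul analyticAt_const
  rw [hT, natCast_le_analyticOrderAt hsum]
  refine ⟨fun ξ => ∑ j, g j ξ * T (EuclideanSpace.single j 1),
    Finset.analyticAt_fun_sum _ fun j _ => (hg j).mul analyticAt_const, ?_⟩
  filter_upwards [Filter.eventually_all.2 hgψ] with ξ hξ
  rw [Finset.smul_sum]
  exact Finset.sum_congr rfl fun j _ => by rw [hξ j, smul_mul_assoc]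

/-! ### Projections of a Puiseux parametrization -/

namespace IsPuiseuxParametrization

variable {n : ℕ} [NeZero n] {A : Set (CSpace n)} {a : CSpace n} {φ : ℂ → CSpace n} {k : ℕ}

/-- Every linear functional of `φ - a` vanishes at the origin to order at least `k`. -/
lemma le_analyticOrderAt (hφ : IsPuiseuxParametrization A a φ k) (T : CSpace n →L[ℂ] ℂ) :
    AnalyticAt ℂ (fun ξ => T (φ ξ - a)) 0 ∧
      (k : ℕ∞) ≤ analyticOrderAt (fun ξ => T (φ ξ - a)) 0 := by
  obtain ⟨-, hdiff, -, -, l, c, -, hfirst, hother⟩ := hφ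
  have hball : Metric.ball (0 : ℂ) 1 ∈ 𝓝 0 := Metric.ball_mem_nhds _ one_pos
  have han : AnalyticAt ℂ (fun ξ => φ ξ - a) 0 :=
    (hdiff.analyticAt hball).sub analyticAt_const
  have hcoord : ∀ j, AnalyticAt ℂ (fun ξ => l (φ ξ - a) j) 0 := fun j =>
    (((EuclideanSpace.proj j : CSpace n →L[ℂ] ℂ).comp
      (l.toContinuousLinearEquiv : CSpace n →L[ℂ] CSpace n)).analyticAt _).comp han
  refine ⟨(T.analyticAt _).comp han, ?_⟩
  have hle := le_analyticOrderAt_linearMap_comp (ψ := fun ξ => l (φ ξ - a)) (k := k) hcoord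
    (fun j => ?_) (T.toLinearMap ∘ₗ l.symm.toLinearEquiv.toLinearMap)
  · simpa using hle
  · by_cases hj : j = 0
    · subst hj
      rw [natCast_le_analyticOrderAt (hcoord 0)]
      refine ⟨fun _ => c, analyticAt_const, ?_⟩
      filter_upwards [hball] with ξ hξ
      rw [hfirst ξ hξ, sub_zero, smul_eq_mul, mul_comm]
    · exact (hother j hj).le

/-- The exponent is a lower bound for the multiplicities of all projections. -/
lemma le_of_isProjectionMultiplicity (hφ : IsPuiseuxParametrization A a φ k)
    {L : Submodule ℂ (CSpace n)} (hL : Module.finrank ℂ L + 1 = n) {m : ℕ}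
    (hm : IsProjectionMultiplicity A a L m) : k ≤ m := by
  obtain ⟨U, V, hU, hV, haU, hmaps, -, hfib, σ, hσ, hcard⟩ := hm
  have hrank : Module.finrank ℂ Lᗮ = 1 := by
    have := L.finrank_add_finrank_orthogonal
    rw [finrank_euclideanSpace_fin] at this
    omega
  let e : Lᗮ ≃L[ℂ] ℂ := ContinuousLinearEquiv.ofFinrankEq (by simp [hrank])
  obtain ⟨han, hk⟩ := hφ.le_analyticOrderAt ((e : Lᗮ →L[ℂ] ℂ).comp (projAlong L))
  obtain ⟨hk1, hdiff, hφ0, ⟨U₀, hU₀, haU₀, hbij⟩, -⟩ := hφ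
  set f : ℂ → ℂ := fun ξ => ((e : Lᗮ →L[ℂ] ℂ).comp (projAlong L)) (φ ξ - a) with hf_def
  have hfe : ∀ ξ, f ξ = e (projAlong L (φ ξ) - projAlong L a) := fun ξ => by simp [hf_def]
  have hball : Metric.ball (0 : ℂ) 1 ∈ 𝓝 0 := Metric.ball_mem_nhds _ one_pos
  have hcont : ContinuousAt φ 0 := (hdiff.differentiableAt hball).continuousAt
  set N : Set ℂ := Metric.ball 0 1 ∩ φ ⁻¹' U
  have hN : N ∈ 𝓝 0 := Filter.inter_mem hball (hcont (hU.mem_nhds (hφ0 ▸ haU)))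
  -- If `f` vanished near `0`, `φ` would send a whole neighbourhood of `0` into the fibre `{a}`,
  -- against injectivity.
  have hfinite : analyticOrderAt f 0 ≠ ⊤ := by
    rw [Ne, analyticOrderAt_eq_top]
    intro hzero
    have hall : ∀ᶠ ξ in 𝓝 (0 : ℂ), ξ = 0 := by
      filter_upwards [hzero, hN] with ξ hξ hξN
      have hmem : φ ξ ∈ A ∩ U ∩ projAlong L ⁻¹' {projAlong L a} := by
        refine ⟨⟨(hbij.mapsTo hξN.1).1, hξN.2⟩, ?_⟩
        rw [hfe, map_eq_zero_iff e e.injective, sub_eq_zero] at hξ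
        exact hξ
      rw [hfib] at hmem
      exact hbij.injOn hξN.1 (Metric.mem_ball_self one_pos) (Eq.trans hmem hφ0.symm)
    have hne : (𝓝[≠] (0 : ℂ)).NeBot := inferInstance
    obtain ⟨x, hx, hx0⟩ := ((hall.filter_mono nhdsWithin_le_nhds).and
      (self_mem_nhdsWithin : {0}ᶜ ∈ 𝓝[≠] (0 : ℂ))).exists
    exact hx0 hx
  obtain ⟨q, hq⟩ := ENat.ne_top_iff_exists.1 hfinite
  have hkq : k ≤ q := by
    rw [← hq] at hk
    exact_mod_cast hk
  have hev := han.eventually_le_encard_fiber (by omega : q ≠ 0) hq.symm hN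
  have : Nontrivial Lᗮ := e.toEquiv.nontrivial
  have hpunct : (𝓝[≠] (projAlong L a)).NeBot := Module.punctured_nhds_neBot ℂ Lᗮ _
  have htend : Filter.Tendsto (fun w : Lᗮ => e (w - projAlong L a)) (𝓝[≠] (projAlong L a))
      (𝓝[≠] (0 : ℂ)) := by
    refine tendsto_nhdsWithin_iff.2 ⟨?_, ?_⟩
    · have hc : Continuous fun w : Lᗮ => e (w - projAlong L a) := by fun_prop
      simpa using (hc.tendsto (projAlong L a)).mono_left nhdsWithin_le_nhds
    · filter_upwards [self_mem_nhdsWithin] with w hw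
      simpa [sub_eq_zero] using hw
  have haV : projAlong L a ∈ V := by
    have : a ∈ A := by
      have := (hbij.mapsTo (Metric.mem_ball_self one_pos)).1
      rwa [hφ0] at this
    exact hmaps ⟨this, haU⟩
  obtain ⟨w, hwσ, hwq, hwV⟩ := ((hσ.frequently_notMem (projAlong L a)).and_eventually
    ((htend.eventually hev).and (mem_nhdsWithin_of_mem_nhds (hV.mem_nhds haV)))).exists
  -- Only an inequality: `U` need not lie inside `U₀`, so the fibre may contain points that `φ` does
  -- not reach.
  have hle : (N ∩ f ⁻¹' {e (w - projAlong L a)}).encard ≤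
      (A ∩ U ∩ projAlong L ⁻¹' {w}).encard := by
    refine Set.encard_le_encard_of_injOn (f := φ) ?_ (hbij.injOn.mono fun ξ hξ => hξ.1.1)
    intro ξ hξ
    refine ⟨⟨(hbij.mapsTo hξ.1.1).1, hξ.1.2⟩, ?_⟩
    have := hξ.2
    rw [mem_preimage, hfe, mem_singleton_iff] at this
    exact sub_left_injective (e.injective this)
  rw [hcard w ⟨hwV, hwσ⟩] at hle
  exact hkq.trans (by exact_mod_cast hwq.trans hle)

/-- The exponent is the multiplicity of the projection along the hyperplane orthogonal to the
tangent line. -/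
lemma mem_projectionMultiplicities (hφ : IsPuiseuxParametrization A a φ k) :
    k ∈ projectionMultiplicities 1 A a := by
  obtain ⟨hk1, hdiff, hφ0, ⟨U, hU, haU, hbij⟩, l, c, hc, hfirst, -⟩ := hφ
  have hk0 : k ≠ 0 := by omega
  -- The unit vector spanning the tangent line at `a`; pairing with it recovers the coordinate in
  -- which `φ - a` is `c ξ ^ k`.
  set u : CSpace n := l.symm (EuclideanSpace.single 0 1) with hu_def
  have hu0 : u ≠ 0 := by simp [hu_def]
  set L : Submodule ℂ (CSpace n) := (ℂ ∙ u)ᗮ with hL_def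
  have huL : u ∈ Lᗮ := (ℂ ∙ u).le_orthogonal_orthogonal (Submodule.mem_span_singleton_self u)
  let e : Lᗮ →L[ℂ] ℂ := (innerSL ℂ u).comp Lᗮ.subtypeL
  have he_inj : Function.Injective e := by
    rw [injective_iff_map_eq_zero]
    intro w hw
    have hwL : (w : CSpace n) ∈ L := Submodule.mem_orthogonal_singleton_iff_inner_right.2 hw
    have : (w : CSpace n) ∈ L ⊓ Lᗮ := ⟨hwL, w.2⟩
    rw [L.inf_orthogonal_eq_bot] at this
    exact Subtype.ext ((Submodule.mem_bot ℂ).1 this)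
  have he_proj : ∀ z, e (projAlong L z) = l z 0 := by
    intro z
    have h1 : inner ℂ u (z - (projAlong L z : CSpace n)) = 0 :=
      Submodule.inner_right_of_mem_orthogonal huL
        (Submodule.sub_starProjection_mem_orthogonal z)
    rw [inner_sub_right, sub_eq_zero] at h1
    have h2 : inner ℂ u z = inner ℂ (EuclideanSpace.single (0 : Fin n) (1 : ℂ)) (l z) := by
      rw [← l.inner_map_map, hu_def, l.apply_symm_apply]
    calc e (projAlong L z) = inner ℂ u (projAlong L z : CSpace n) := rfl
      _ = l z 0 := by rw [← h1, h2, EuclideanSpace.inner_single_left, map_one, one_mul]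
  have heφ : ∀ ξ ∈ Metric.ball (0 : ℂ) 1,
      e (projAlong L (φ ξ) - projAlong L a) = c * ξ ^ k := by
    intro ξ hξ
    rw [← map_sub, he_proj, hfirst ξ hξ]
  have hfib : ∀ S : Set Lᗮ, A ∩ U ∩ projAlong L ⁻¹' S =
      φ '' {ξ ∈ Metric.ball (0 : ℂ) 1 | projAlong L (φ ξ) ∈ S} := by
    intro S
    rw [← hbij.image_eq]
    ext z
    constructor
    · rintro ⟨⟨ξ, hξ, rfl⟩, hz⟩
      exact ⟨ξ, ⟨hξ, hz⟩, rfl⟩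
    · rintro ⟨ξ, ⟨hξ, hz⟩, rfl⟩
      exact ⟨⟨ξ, hξ, rfl⟩, hz⟩
  have hpre : ∀ w : Lᗮ, ∀ ξ ∈ Metric.ball (0 : ℂ) 1,
      projAlong L (φ ξ) = w ↔ c * ξ ^ k = e (w - projAlong L a) := by
    intro w ξ hξ
    rw [← heφ ξ hξ, he_inj.eq_iff, sub_left_inj]
  have hec : Continuous fun w : Lᗮ => e (w - projAlong L a) := by fun_prop
  -- This dictates the radius `‖c‖` of `V` below: the preimage of `V` under `c ξ ^ k` is exactly the
  -- unit disc, which gives properness and keeps all `k` roots in the domain of `φ`.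
  have hnorm : ∀ ξ : ℂ, ‖c * ξ ^ k‖ < ‖c‖ → ξ ∈ Metric.ball (0 : ℂ) 1 := by
    intro ξ hξ
    rw [norm_mul, norm_pow] at hξ
    have h1 : ‖ξ‖ ^ k < 1 := by
      have := norm_pos_iff.2 hc
      by_contra! hcon
      nlinarith
    rw [mem_ball_zero_iff]
    exact lt_of_pow_lt_pow_left₀ k zero_le_one (by simpa using h1)
  have hpunct : (𝓝[≠] (projAlong L a)).NeBot := by
    have : Nontrivial Lᗮ := ⟨⟨⟨u, huL⟩, 0, fun h => hu0 (congrArg Subtype.val h)⟩⟩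
    exact Module.punctured_nhds_neBot ℂ Lᗮ _
  refine ⟨L, ?_, U, {w | ‖e (w - projAlong L a)‖ < ‖c‖}, hU,
    isOpen_lt hec.norm continuous_const, haU, ?_, ?_, ?_, {projAlong L a}, ?_, ?_⟩
  · have h1 := (ℂ ∙ u).finrank_add_finrank_orthogonal
    rw [finrank_span_singleton hu0, finrank_euclideanSpace_fin, ← hL_def] at h1
    omega
  · rw [← hbij.image_eq]
    rintro _ ⟨ξ, hξ, rfl⟩
    rw [mem_ofPred_eq, heφ ξ hξ, norm_mul, norm_pow]
    exact mul_lt_of_lt_one_right (norm_pos_iff.2 hc)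
      (pow_lt_one₀ (norm_nonneg _) (mem_ball_zero_iff.1 hξ) hk0)
  · intro K hKV hK
    have hK' : IsCompact ((fun w : Lᗮ => e (w - projAlong L a)) '' K) := hK.image hec
    -- As a preimage under a polynomial on all of `ℂ`, this set is closed in `ℂ` and not merely in
    -- the open disc.
    have hset : {ξ ∈ Metric.ball (0 : ℂ) 1 | projAlong L (φ ξ) ∈ K} =
        (fun ξ : ℂ => c * ξ ^ k) ⁻¹' ((fun w : Lᗮ => e (w - projAlong L a)) '' K) := by
      ext ξ
      constructor
      · rintro ⟨hξ, hξK⟩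
        exact ⟨_, hξK, heφ ξ hξ⟩
      · rintro ⟨w, hwK, hw⟩
        have hξ : ξ ∈ Metric.ball (0 : ℂ) 1 := hnorm ξ ((congrArg norm hw.symm).trans_lt (hKV hwK))
        refine ⟨hξ, ?_⟩
        rwa [(hpre w ξ hξ).2 hw.symm]
    rw [hfib]
    refine IsCompact.image_of_continuousOn ?_ (hdiff.continuousOn.mono fun ξ hξ => hξ.1)
    refine Metric.isCompact_of_isClosed_isBounded ?_
      (Metric.isBounded_ball.subset fun ξ hξ => hξ.1)
    rw [hset]
    exact hK'.isClosed.preimage (by fun_prop)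
  · rw [hfib]
    have hset : {ξ ∈ Metric.ball (0 : ℂ) 1 | projAlong L (φ ξ) ∈ ({projAlong L a} : Set Lᗮ)} =
        {0} := by
      ext ξ
      constructor
      · rintro ⟨hξ, hξa⟩
        have := (hpre _ ξ hξ).1 hξa
        rw [sub_self, map_zero, mul_eq_zero] at this
        exact eq_zero_of_pow_eq_zero (this.resolve_left hc)
      · rintro rfl
        exact ⟨Metric.mem_ball_self one_pos, by simp [hφ0]⟩
    rw [hset, image_singleton, hφ0]
  · rw [isClosed_singleton.isNowhereDense_iff, interior_singleton]
  · rintro w ⟨hwV, hwa⟩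
    have hset : {ξ ∈ Metric.ball (0 : ℂ) 1 | projAlong L (φ ξ) ∈ ({w} : Set Lᗮ)} =
        {ξ | ξ ^ k = e (w - projAlong L a) / c} := by
      ext ξ
      rw [mem_ofPred_eq, mem_ofPred_eq, eq_div_iff hc, mul_comm (ξ ^ k)]
      constructor
      · rintro ⟨hξ, hξw⟩
        exact (hpre w ξ hξ).1 hξw
      · intro h
        have hξ := hnorm ξ ((congrArg norm h).trans_lt hwV)
        exact ⟨hξ, (hpre w ξ hξ).2 h⟩
    have hne : e (w - projAlong L a) ≠ 0 := by
      rw [Ne, map_eq_zero_iff e he_inj, sub_eq_zero]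
      exact hwa
    rw [hfib, (hbij.injOn.mono fun ξ hξ => hξ.1).encard_image, hset,
      Complex.encard_setOf_pow_eq hk0 (div_ne_zero hne hc)]

end IsPuiseuxParametrization

theorem mainTheorem10 {n : ℕ} [NeZero n] (A : Set (CSpace n))
    (hA : IsIrreducibleAlgebraicCurve A) (a : CSpace n) (ha : IsSingularPoint A a)
    (φ : ℂ → CSpace n) (k : ℕ) (hφ : IsPuiseuxParametrization A a φ k) :
    IsMultiplicity 1 A a k := by
  exact ⟨hφ.mem_projectionMultiplicities, fun _ ⟨_, hL, hm⟩ =>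
    hφ.le_of_isProjectionMultiplicity hL hm⟩
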